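/- A polyhedral fan $\Sigma$ in $\mathbb{Q}^d$ is a nonempty finite set of finitely generated convex cones in $\mathbb{Q}^d$, closed under taking faces, any two of which meet in a common face. It is hereditary if for every $\tau\in\Sigma$ the graph whose vertices are the $d$-dimensional cones of $\Sigma$ containing $\tau$, two of them being adjacent when they share a $(d-1)$-dimensional face, is nonempty and connected. A cone of $\Sigma$ is interior if it is not contained in a $(d-1)$-dimensional cone of $\Sigma$ that lies in exactly one $d$-dimensional cone of $\Sigma$; let $\Sigma_k^0$ be the set of interior $k$-dimensional cones (so $\Sigma_d^0=\Sigma_d$). Let $S=\mathbb{Q}[x_1,\dots,x_d]$ and let $I_\tau\subseteq S$ be the ideal of polynomials vanishing on the linear span of $\tau$. Theorem. Let $\Sigma$ be a hereditary polyhedral fan in $\mathbb{Q}^d$, choose an orientation of the linear span of each interior cone, and let $\mathcal{C}$ be the complex of $S$-modules $$0\to\bigoplus_{\sigma\in\Sigma_d}S\xrightarrow{\partial_d}\bigoplus_{\tau\in\Sigma_{d-1}^0}S/I_\tau\xrightarrow{\partial_{d-1}}\bigoplus_{\psi\in\Sigma_{d-2}^0}S/I_\psi\to\cdots\xrightarrow{\partial_2}\bigoplus_{v\in\Sigma_1^0}S/I_v\to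 0$$ with the cellular differential: the component $S/I_\alpha\to S/I_\beta$ of $\partial_k$ is the canonical projection times the incidence number $[\alpha:\beta]=\pm1$ if $\beta$ is a facet of $\alpha$, and zero otherwise. Then for every $i$ with $1\le i\le d$: 1. every prime ideal in the support of $H_{d-i}(\mathcal{C})$ has codimension (height) at least $i+1$; 2. every associated prime of $H_{d-i}(\mathcal{C})$ of codimension $i+1$ is generated by linear forms. Here $H_0(\mathcal{C})=0$, since $\mathcal{C}$ ends in degree $1$. -/

import Mathlib

set_option maxSynthPendingDepth 3



noncomputable section

namespace FanComplex

/-- The linear span `τ̄` of a cone in `ℚ^d`. -/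
def linSpan {d : ℕ} (τ : PointedCone ℚ (Fin d → ℚ)) : Submodule ℚ (Fin d → ℚ) :=
  Submodule.span ℚ (τ : Set (Fin d → ℚ))

/-- The dimension of a cone is the dimension of its linear span. -/
def dim {d : ℕ} (τ : PointedCone ℚ (Fin d → ℚ)) : ℕ := Module.finrank ℚ (linSpan τ)

/-- A (rational) polyhedral fan in `ℚ^d`: a nonempty finite collection of finitely generated convex
cones, closed under taking faces, in which any two cones meet in a common face of both (the last
field is applied to both orders of the two cones). The cones may or may not be strongly convex. -/
structure PolyhedralFan (d : ℕ) where
  cones : Finset (PointedCone ℚ (Fin d → ℚ))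
  nonempty : cones.Nonempty
  fg : ∀ σ ∈ cones, σ.FG
  face_mem : ∀ σ ∈ cones, ∀ τ : PointedCone ℚ (Fin d → ℚ), τ.IsFaceOf σ → τ ∈ cones
  inf_isFaceOf : ∀ σ ∈ cones, ∀ τ ∈ cones, (σ ⊓ τ).IsFaceOf σ

namespace PolyhedralFan

variable {d : ℕ} (F : PolyhedralFan d)

/-- The `d`-dimensional cones of the star of `τ`. -/
def StarChamber (τ : PointedCone ℚ (Fin d → ℚ)) : Type :=
  {σ : PointedCone ℚ (Fin d → ℚ) // σ ∈ F.cones ∧ dim σ = d ∧ τ ≤ σ}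

/-- The dual graph of the star of `τ`: its vertices are the `d`-dimensional cones that contain `τ`;
two of them are adjacent if they share a `(d-1)`-dimensional face. -/
def starDualGraph (τ : PointedCone ℚ (Fin d → ℚ)) : SimpleGraph (F.StarChamber τ) where
  Adj σ σ' := σ ≠ σ' ∧ dim (σ.1 ⊓ σ'.1) + 1 = d
  symm := ⟨fun σ σ' h => ⟨h.1.symm, by rw [inf_comm]; exact h.2⟩⟩
  loopless := ⟨fun _ h => h.1 rfl⟩

/-- The fan is hereditary: the dual graph of the star of each of its cones is connected
(in particular nonempty, so that every cone is a face of a `d`-dimensional one). -/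
def IsHereditary : Prop := ∀ τ ∈ F.cones, (F.starDualGraph τ).Connected

/-- A boundary facet: a `(d-1)`-dimensional cone that lies in exactly one `d`-dimensional cone. -/
def IsBoundaryFacet (ρ : PointedCone ℚ (Fin d → ℚ)) : Prop :=
  ρ ∈ F.cones ∧ dim ρ + 1 = d ∧ ∃! σ, σ ∈ F.cones ∧ dim σ = d ∧ ρ ≤ σ

/-- A cone is interior if it is not contained in a boundary facet, i.e. does not belong to the
boundary subcomplex. (When every cone is a face of a `d`-dimensional one, this says that the cone is
not contained in the topological boundary of the union of the cones.) -/
def IsInterior (τ : PointedCone ℚ (Fin d → ℚ)) : Prop :=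
  ∀ ρ, F.IsBoundaryFacet ρ → ¬ τ ≤ ρ

/-- The cells of the complex in degree `k`: the interior `k`-dimensional cones for `k ≥ 1`, and
none for `k = 0` (the complex ends in degree `1`). -/
def Cell (k : ℕ) : Type :=
  {τ : PointedCone ℚ (Fin d → ℚ) // τ ∈ F.cones ∧ 0 < k ∧ dim τ = k ∧ F.IsInterior τ}

instance (k : ℕ) : Finite (F.Cell k) :=
  Finite.of_injective (β := {τ // τ ∈ F.cones}) (fun τ => ⟨τ.1, τ.2.1⟩)
    (fun _ _ h => Subtype.ext (congrArg (fun x => x.1) h))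

instance (k : ℕ) : Fintype (F.Cell k) := Fintype.ofFinite _

/-- The ideal `I_τ` of all polynomials that vanish on the linear span of `τ`. -/
def spanIdeal (τ : PointedCone ℚ (Fin d → ℚ)) : Ideal (MvPolynomial (Fin d) ℚ) :=
  MvPolynomial.vanishingIdeal ℚ (linSpan τ : Set (Fin d → ℚ))

theorem linSpan_mono {τ σ : PointedCone ℚ (Fin d → ℚ)} (h : τ ≤ σ) : linSpan τ ≤ linSpan σ :=
  Submodule.span_mono h

theorem spanIdeal_anti {τ σ : PointedCone ℚ (Fin d → ℚ)} (h : τ ≤ σ) :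
    spanIdeal σ ≤ spanIdeal τ :=
  MvPolynomial.vanishingIdeal_anti_mono (linSpan_mono h)

/-- The chains `C_k = ⨁_τ S / I_τ`, over the (finitely many) cells `τ` of
degree `k`. -/
abbrev Chain (k : ℕ) : Type :=
  (τ : F.Cell k) → MvPolynomial (Fin d) ℚ ⧸ spanIdeal τ.1

/-- An orientation of every cell, given by an ordered basis of its linear span. -/
abbrev CellOrientation : Type :=
  ∀ (k : ℕ) (τ : F.Cell k), Module.Basis (Fin k) ℚ (linSpan τ.1)

variable {F}
variable (o : F.CellOrientation)

/-- The determinant, in the chosen basis of `ᾱ`, of `w` followed by the chosen basis of `β̄`. -/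
def orientDet {k : ℕ} (α : F.Cell (k + 1)) (β : F.Cell k) (h : β.1 ≤ α.1) (w : linSpan α.1) : ℚ :=
  (o (k + 1) α).det (Fin.cons w fun j => Submodule.inclusion (linSpan_mono h) (o k β j))

open scoped Classical in
/-- The incidence number `[α : β]`. It is zero unless `β` is a face of `α`. If it is, it is `1` or
`-1` according as a vector of `α` outside `β`, followed by the basis of `β̄`, is positively or
negatively oriented in `ᾱ`; this does not depend on the vector. -/
def incidence {k : ℕ} (α : F.Cell (k + 1)) (β : F.Cell k) : ℤ :=
  if h : β.1 ≤ α.1 then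
    if ∃ w : linSpan α.1, (w : Fin d → ℚ) ∈ α.1 ∧ 0 < orientDet o α β h w then 1
    else if ∃ w : linSpan α.1, (w : Fin d → ℚ) ∈ α.1 ∧ orientDet o α β h w < 0 then -1
    else 0
  else 0

open scoped Classical in
/-- The projection `S / I_α → S / I_β` for a face `β` of `α` (and zero otherwise). -/
def proj (α β : PointedCone ℚ (Fin d → ℚ)) :
    (MvPolynomial (Fin d) ℚ ⧸ spanIdeal α) →ₗ[MvPolynomial (Fin d) ℚ]
      (MvPolynomial (Fin d) ℚ ⧸ spanIdeal β) :=
  if h : β ≤ α then Submodule.mapQ _ _ LinearMap.id (spanIdeal_anti h) else 0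

/-- The cellular differential `∂_{k+1} : C_{k+1} → C_k`. -/
def boundary (k : ℕ) : F.Chain (k + 1) →ₗ[MvPolynomial (Fin d) ℚ] F.Chain k :=
  LinearMap.pi fun β => ∑ α : F.Cell (k + 1),
    incidence o α β • (proj α.1 β.1 ∘ₗ LinearMap.proj α)

/-! The differential squares to zero. -/

theorem mem_of_mem_linSpan {G C : PointedCone ℚ (Fin d → ℚ)} (hF : G.IsFaceOf C)
    {x : Fin d → ℚ} (hx : x ∈ C) (hs : x ∈ linSpan G) : x ∈ G := by
  have key : ∀ y ∈ linSpan G, ∃ a ∈ G, ∃ b ∈ G, y = a - b := by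
    intro y hy
    refine Submodule.span_induction (p := fun y _ => ∃ a ∈ G, ∃ b ∈ G, y = a - b) ?_ ?_ ?_ ?_ hy
    · intro z hz
      exact ⟨z, hz, 0, G.zero_mem, by simp⟩
    · exact ⟨0, G.zero_mem, 0, G.zero_mem, by simp⟩
    · rintro y z - - ⟨a, ha, b, hb, rfl⟩ ⟨a', ha', b', hb', rfl⟩
      exact ⟨a + a', G.add_mem ha ha', b + b', G.add_mem hb hb', by abel⟩
    · rintro c y - ⟨a, ha, b, hb, rfl⟩
      rcases le_total 0 c with hc | hc
      · exact ⟨c • a, G.smul_mem hc ha, c • b, G.smul_mem hc hb, smul_sub _ _ _⟩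
      · refine ⟨(-c) • b, G.smul_mem (neg_nonneg.2 hc) hb, (-c) • a,
          G.smul_mem (neg_nonneg.2 hc) ha, ?_⟩
        rw [smul_sub, neg_smul, neg_smul]; abel
  obtain ⟨a, ha, b, hb, rfl⟩ := key x hs
  refine hF.mem_of_add_mem_left hx (hF.le hb) ?_
  simpa using ha

theorem le_linSpan (C : PointedCone ℚ (Fin d → ℚ)) {x : Fin d → ℚ} (hx : x ∈ C) : x ∈ linSpan C :=
  Submodule.subset_span hx

theorem Cell.isFaceOf {k l : ℕ} {α : F.Cell k} {β : F.Cell l} (h : β.1 ≤ α.1) :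
    β.1.IsFaceOf α.1 := by
  have := F.inf_isFaceOf α.1 α.2.1 β.1 β.2.1
  rwa [inf_eq_right.2 h] at this

theorem orientDet_smul_form {k : ℕ} (α : F.Cell (k + 1)) (β : F.Cell k) (h : β.1 ≤ α.1)
    (w : linSpan α.1) (v : Fin k → linSpan β.1) :
    (o (k + 1) α).det (Fin.cons w fun j => Submodule.inclusion (linSpan_mono h) (v j)) =
      orientDet o α β h w * (o k β).det v := by
  have := ((((o (k + 1) α).det.curryLeft w).compLinearMap
    (Submodule.inclusion (linSpan_mono h)))).eq_smul_basis_det (o k β)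
  have h2 := congrArg (fun f => f v) this
  simp only [AlternatingMap.compLinearMap_apply, AlternatingMap.smul_apply, smul_eq_mul] at h2
  exact h2

theorem orientDet_eq_zero_iff {k : ℕ} (α : F.Cell (k + 1)) (β : F.Cell k) (h : β.1 ≤ α.1)
    (w : linSpan α.1) : orientDet o α β h w = 0 ↔ (w : Fin d → ℚ) ∈ linSpan β.1 := by
  have hli : LinearIndependent ℚ
      (fun j => Submodule.inclusion (linSpan_mono h) (o k β j)) :=
    (o k β).linearIndependent.map' _ (Submodule.ker_inclusion _ _ _)
  have hcard : Fintype.card (Fin (k + 1)) = Module.finrank ℚ (linSpan α.1) := by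
    rw [Module.finrank_eq_card_basis (o (k + 1) α)]
  have hspan : Submodule.span ℚ
      (Set.range fun j => Submodule.inclusion (linSpan_mono h) (o k β j)) =
      (⊤ : Submodule ℚ (linSpan β.1)).map (Submodule.inclusion (linSpan_mono h)) := by
    rw [← (o k β).span_eq, Submodule.map_span, ← Set.range_comp]; rfl
  have hmem : (w : Fin d → ℚ) ∈ linSpan β.1 ↔ w ∈ Submodule.span ℚ
      (Set.range fun j => Submodule.inclusion (linSpan_mono h) (o k β j)) := by
    rw [hspan, Submodule.map_top, Submodule.range_inclusion]
    simp
  rw [hmem, ← not_iff_not]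
  have := linearIndependent_finCons (K := ℚ) (x := w)
    (v := fun j => Submodule.inclusion (linSpan_mono h) (o k β j))
  have h2 := Module.Basis.is_basis_iff_det (o (k + 1) α)
    (v := (Fin.cons w fun j => Submodule.inclusion (linSpan_mono h) (o k β j)))
  rw [isUnit_iff_ne_zero] at h2
  change (orientDet o α β h w ≠ 0) ↔ _
  rw [show (orientDet o α β h w ≠ 0) ↔ _ from h2.symm]
  constructor
  · intro hb; exact (this.1 hb.1).2
  · intro hw
    have hl := this.2 ⟨hli, hw⟩
    exact ⟨hl, hl.span_eq_top_of_card_eq_finrank' hcard⟩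

theorem orientDet_add_smul {k : ℕ} (α : F.Cell (k + 1)) (β : F.Cell k) (h : β.1 ≤ α.1)
    (w w' : linSpan α.1) (c : ℚ) :
    orientDet o α β h (w + c • w') = orientDet o α β h w + c * orientDet o α β h w' := by
  have e : ∀ x, orientDet o α β h x = ((o (k + 1) α).det.curryLeft x)
      (fun j => Submodule.inclusion (linSpan_mono h) (o k β j)) := fun _ => rfl
  simp only [e, map_add, map_smul, AlternatingMap.add_apply, AlternatingMap.smul_apply,
    smul_eq_mul]

/-- All vectors of `α` lie on one side of `β̄`. -/
theorem orientDet_mul_nonneg {k : ℕ} (α : F.Cell (k + 1)) (β : F.Cell k) (h : β.1 ≤ α.1)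
    (w w' : linSpan α.1) (hw : (w : Fin d → ℚ) ∈ α.1) (hw' : (w' : Fin d → ℚ) ∈ α.1) :
    0 ≤ orientDet o α β h w * orientDet o α β h w' := by
  by_contra hneg
  push Not at hneg
  have hw0 : orientDet o α β h w' ≠ 0 := by rintro h0; simp [h0] at hneg
  set c := -(orientDet o α β h w / orientDet o α β h w') with hc
  have hcpos : 0 < c := by
    have : orientDet o α β h w / orientDet o α β h w' < 0 := by
      rcases mul_neg_iff.1 hneg with ⟨a, b⟩ | ⟨a, b⟩
      · exact div_neg_of_pos_of_neg a b
      · exact div_neg_of_neg_of_pos a b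
    linarith
  have hz : orientDet o α β h (w + c • w') = 0 := by
    rw [orientDet_add_smul, hc]; field_simp; ring
  rw [orientDet_eq_zero_iff] at hz
  have hF := Cell.isFaceOf h
  have hsum : ((w + c • w' : linSpan α.1) : Fin d → ℚ) ∈ α.1 :=
    α.1.add_mem hw (α.1.smul_mem hcpos.le hw')
  have hm := mem_of_mem_linSpan hF hsum hz
  have : (w : Fin d → ℚ) ∈ β.1 :=
    hF.mem_of_add_mem_left hw (α.1.smul_mem hcpos.le hw') hm
  have := (orientDet_eq_zero_iff o α β h w).2 (le_linSpan _ this)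
  rw [this] at hneg; simp at hneg

/-- The incidence number is the orientation sign of any vector of `α` outside `β`. -/
theorem incidence_eq_sign {k : ℕ} (α : F.Cell (k + 1)) (β : F.Cell k) (h : β.1 ≤ α.1)
    (w : linSpan α.1) (hw : (w : Fin d → ℚ) ∈ α.1) (hwβ : (w : Fin d → ℚ) ∉ β.1) :
    incidence o α β = (SignType.sign (orientDet o α β h w) : ℤ) := by
  have hne : orientDet o α β h w ≠ 0 := fun h0 => hwβ
    (mem_of_mem_linSpan (Cell.isFaceOf h) hw ((orientDet_eq_zero_iff o α β h w).1 h0))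
  rw [incidence, dif_pos h]
  rcases lt_or_gt_of_ne hne with hl | hg
  · rw [if_neg, if_pos ⟨w, hw, hl⟩, sign_neg hl]; rfl
    rintro ⟨w', hw', hp⟩
    have := orientDet_mul_nonneg o α β h w w' hw hw'
    nlinarith [mul_neg_of_neg_of_pos hl hp]
  · rw [if_pos ⟨w, hw, hg⟩, sign_pos hg]; rfl

theorem incidence_eq_zero {k : ℕ} (α : F.Cell (k + 1)) (β : F.Cell k) (h : ¬ β.1 ≤ α.1) :
    incidence o α β = 0 := by rw [incidence, dif_neg h]

theorem exists_mem_not_mem {k l : ℕ} (α : F.Cell k) (β : F.Cell l) (h : β.1 ≤ α.1)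
    (hkl : l < k) : ∃ w ∈ α.1, w ∉ β.1 := by
  by_contra hc
  push Not at hc
  have : α.1 = β.1 := le_antisymm hc h
  have h1 := α.2.2.2.1
  have h2 := β.2.2.2.1
  rw [this] at h1
  omega

/-- For a chain of faces `γ ⊂ β ⊂ α`, the product of the incidence numbers is the orientation sign
of a vector of `α` outside `β`, a vector of `β` outside `γ`, and the basis of `γ̄`. -/
theorem incidence_mul {k : ℕ} (α : F.Cell (k + 2)) (β : F.Cell (k + 1)) (γ : F.Cell k)
    (h : β.1 ≤ α.1) (h' : γ.1 ≤ β.1) (w v : linSpan α.1)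
    (hw : (w : Fin d → ℚ) ∈ α.1) (hwβ : (w : Fin d → ℚ) ∉ β.1)
    (hv : (v : Fin d → ℚ) ∈ β.1) (hvγ : (v : Fin d → ℚ) ∉ γ.1) :
    incidence o α β * incidence o β γ =
      (SignType.sign ((o (k + 2) α).det (Fin.cons w (Fin.cons v fun j =>
        Submodule.inclusion (linSpan_mono (h'.trans h)) (o k γ j)))) : ℤ) := by
  rw [incidence_eq_sign o α β h w hw hwβ,
    incidence_eq_sign o β γ h' ⟨v, le_linSpan _ hv⟩ hv hvγ]
  have := orientDet_smul_form o α β h w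
    (Fin.cons ⟨v, le_linSpan _ hv⟩ fun j => Submodule.inclusion (linSpan_mono h') (o k γ j))
  have e : (fun j => Submodule.inclusion (linSpan_mono h)
      ((Fin.cons ⟨v, le_linSpan _ hv⟩ fun j =>
        Submodule.inclusion (linSpan_mono h') (o k γ j) : Fin (k + 1) → linSpan β.1) j)) =
      Fin.cons v fun j => Submodule.inclusion (linSpan_mono (h'.trans h)) (o k γ j) := by
    funext j
    refine Fin.cases ?_ (fun j => ?_) j <;> rfl
  rw [e] at this
  rw [this, sign_mul]
  simp only [orientDet]
  push_cast
  rfl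

theorem det_cons_swap {k : ℕ} (α : F.Cell (k + 2)) (w v : linSpan α.1)
    (u : Fin k → linSpan α.1) :
    (o (k + 2) α).det (Fin.cons w (Fin.cons v u)) =
      -(o (k + 2) α).det (Fin.cons v (Fin.cons w u)) := by
  rw [← (o (k + 2) α).det.map_swap _ (i := 0) (j := 1) (by simp)]
  congr 1
  funext j
  refine Fin.cases ?_ (fun j => Fin.cases ?_ (fun j => ?_) j) j
  · simp
  · change _ = (Fin.cons v (Fin.cons w u) : Fin (k + 2) → _) (Equiv.swap 0 1 1)
    simp
  · have : Equiv.swap (0 : Fin (k + 2)) 1 j.succ.succ = j.succ.succ :=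
      Equiv.swap_apply_of_ne_of_ne (Fin.succ_ne_zero _)
        (by rw [← Fin.succ_zero_eq_one]; exact fun h => Fin.succ_ne_zero _ (Fin.succ_injective _ h))
    simp [this]

theorem plucker_nonneg {G C : PointedCone ℚ (Fin d → ℚ)} (hG : G.IsFaceOf C)
    (p q : (Fin d → ℚ) →ₗ[ℚ] ℚ)
    (hpq : ∀ x ∈ linSpan C, (p x = 0 ∧ q x = 0) ↔ x ∈ linSpan G)
    {a b c : Fin d → ℚ} (ha : a ∈ C) (hb : b ∈ C) (hc : c ∈ C) (hbG : b ∉ G)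
    (hab : 0 ≤ p a * q b - q a * p b) (hbc : 0 ≤ p b * q c - q b * p c) :
    0 ≤ p a * q c - q a * p c := by
  by_contra hac
  push Not at hac
  set z := (p b * q c - q b * p c) • a + (p a * q b - q a * p b) • c with hz
  have hzC : z ∈ C := C.add_mem (C.smul_mem hbc ha) (C.smul_mem hab hc)
  have hbC : (-(p a * q c - q a * p c)) • b ∈ C := C.smul_mem (by linarith) hb
  have hsC := C.add_mem hbC hzC
  have hs : (-(p a * q c - q a * p c)) • b + z ∈ linSpan G := by
    rw [← hpq _ (le_linSpan _ hsC)]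
    simp only [hz, map_add, map_smul, smul_eq_mul]
    constructor <;> ring
  have h1 := hG.mem_of_add_mem_left hbC hzC (mem_of_mem_linSpan hG hsC hs)
  apply hbG
  have h2 := G.smul_mem (r := (-(p a * q c - q a * p c))⁻¹)
    (inv_nonneg.2 (by linarith)) h1
  rwa [smul_smul, inv_mul_cancel₀ (by linarith), one_smul] at h2

/-- If `C` is a finitely generated cone of dimension two modulo its face `G`, then some vector of
`C` is extremal (in the sense of the given coordinates modulo `G`). -/
theorem exists_extremal {G C : PointedCone ℚ (Fin d → ℚ)} (hC : C.FG) (hG : G.IsFaceOf C)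
    (hne : ¬ C ≤ G) (p q : (Fin d → ℚ) →ₗ[ℚ] ℚ)
    (hpq : ∀ x ∈ linSpan C, (p x = 0 ∧ q x = 0) ↔ x ∈ linSpan G) :
    ∃ w ∈ C, w ∉ G ∧ ∀ y ∈ C, 0 ≤ p w * q y - q w * p y := by
  classical
  obtain ⟨s, hs⟩ := hC
  have hsC : ∀ x ∈ s, x ∈ C := fun x hx => hs ▸ Submodule.subset_span hx
  have step : ∀ t : Finset (Fin d → ℚ), (∀ x ∈ t, x ∈ C ∧ x ∉ G) → t.Nonempty →
      ∃ w ∈ t, ∀ y ∈ t, 0 ≤ p w * q y - q w * p y := by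
    intro t
    induction t using Finset.induction_on with
    | empty => intro _ h; simp at h
    | insert a t _ ih =>
      intro hx _
      rcases t.eq_empty_or_nonempty with rfl | hne'
      · refine ⟨a, by simp, fun y hy => ?_⟩
        obtain rfl : y = a := by simpa using hy
        exact (by ring : p y * q y - q y * p y = 0).ge
      · obtain ⟨w, hw, hmin⟩ := ih (fun x hx' => hx x (Finset.mem_insert_of_mem hx')) hne'
        have hwx := hx w (Finset.mem_insert_of_mem hw)
        have hax := hx a (Finset.mem_insert_self _ _)
        rcases le_total 0 (p w * q a - q w * p a) with h0 | h0
        · refine ⟨w, Finset.mem_insert_of_mem hw, fun y hy => ?_⟩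
          rcases Finset.mem_insert.1 hy with rfl | hy
          · exact h0
          · exact hmin y hy
        · refine ⟨a, Finset.mem_insert_self _ _, fun y hy => ?_⟩
          rcases Finset.mem_insert.1 hy with rfl | hy
          · exact (by ring : p y * q y - q y * p y = 0).ge
          · exact plucker_nonneg hG p q hpq hax.1 hwx.1
              (hx y (Finset.mem_insert_of_mem hy)).1 hwx.2 (by linarith) (hmin y hy)
  have hne2 : (s.filter fun x => x ∉ G).Nonempty := by
    by_contra h
    rw [Finset.not_nonempty_iff_eq_empty, Finset.filter_eq_empty_iff] at h
    apply hne
    rw [← hs]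
    exact Submodule.span_le.2 fun x hx => not_not.1 (h hx)
  obtain ⟨w, hw, hmin⟩ := step (s.filter fun x => x ∉ G)
    (fun x hx => ⟨hsC x (Finset.mem_filter.1 hx).1, (Finset.mem_filter.1 hx).2⟩) hne2
  refine ⟨w, hsC w (Finset.mem_filter.1 hw).1, (Finset.mem_filter.1 hw).2, fun y hy => ?_⟩
  rw [← hs] at hy
  refine Submodule.span_induction (p := fun y _ => 0 ≤ p w * q y - q w * p y) ?_ ?_ ?_ ?_ hy
  · intro x hx
    by_cases hxG : x ∈ G
    · have h0 := (hpq x (le_linSpan _ (hsC x hx))).2 (le_linSpan _ hxG)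
      simp [h0.1, h0.2]
    · exact hmin x (Finset.mem_filter.2 ⟨hx, hxG⟩)
  · simp
  · intro x y _ _ h1 h2
    simp only [map_add]
    linarith
  · intro c x _ h1
    have e : ∀ f : (Fin d → ℚ) →ₗ[ℚ] ℚ, f (c • x) = (c : ℚ) * f x := fun f => f.map_smul (c : ℚ) x
    rw [e, e]
    have := mul_nonneg c.2 h1
    have e2 : p w * ((c : ℚ) * q x) - q w * ((c : ℚ) * p x) =
      (c : ℚ) * (p w * q x - q w * p x) := by ring
    rw [e2]; exact this

theorem exists_coords {U W : Submodule ℚ (Fin d → ℚ)} (h : U ≤ W)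
    (hd : Module.finrank ℚ W = Module.finrank ℚ U + 2) :
    ∃ p q : (Fin d → ℚ) →ₗ[ℚ] ℚ, (∀ x ∈ W, (p x = 0 ∧ q x = 0) ↔ x ∈ U) ∧
      ∀ a b : ℚ, ∃ x ∈ W, p x = a ∧ q x = b := by
  have hcard : Module.finrank ℚ (W ⧸ U.submoduleOf W) = 2 := by
    have h1 := Submodule.finrank_quotient_add_finrank (U.submoduleOf W)
    have h2 : Module.finrank ℚ (U.submoduleOf W) = Module.finrank ℚ U :=
      (Submodule.submoduleOfEquivOfLe h).finrank_eq
    omega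
  let B := Module.finBasisOfFinrankEq ℚ _ hcard
  obtain ⟨p, hp⟩ := LinearMap.exists_extend ((B.coord 0).comp (U.submoduleOf W).mkQ)
  obtain ⟨q, hq⟩ := LinearMap.exists_extend ((B.coord 1).comp (U.submoduleOf W).mkQ)
  have hp' : ∀ x : W, p x = B.repr ((U.submoduleOf W).mkQ x) 0 := fun x =>
    congrArg (fun f => f x) hp
  have hq' : ∀ x : W, q x = B.repr ((U.submoduleOf W).mkQ x) 1 := fun x =>
    congrArg (fun f => f x) hq
  refine ⟨p, q, fun x hx => ?_, fun a b => ?_⟩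
  · rw [hp' ⟨x, hx⟩, hq' ⟨x, hx⟩]
    have : x ∈ U ↔ (U.submoduleOf W).mkQ ⟨x, hx⟩ = 0 := by
      rw [Submodule.mkQ_apply, Submodule.Quotient.mk_eq_zero]; rfl
    rw [this]
    constructor
    · rintro ⟨h0, h1⟩
      apply B.repr.injective
      ext j
      fin_cases j
      · simpa using h0
      · simpa using h1
    · intro h0; simp [h0]
  · obtain ⟨x, hx⟩ := (U.submoduleOf W).mkQ_surjective (a • B 0 + b • B 1)
    refine ⟨x, x.2, ?_, ?_⟩
    · rw [hp', hx]; simp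
    · rw [hq', hx]; simp

theorem linSpan_eq_sup {k : ℕ} {β : F.Cell (k + 1)} {γ : F.Cell k} (h : γ.1 ≤ β.1)
    {x : Fin d → ℚ} (hx : x ∈ β.1) (hxγ : x ∉ γ.1) :
    linSpan β.1 = linSpan γ.1 ⊔ Submodule.span ℚ {x} := by
  have hle : linSpan γ.1 ⊔ Submodule.span ℚ {x} ≤ linSpan β.1 :=
    sup_le (linSpan_mono h) (Submodule.span_le.2 (by simpa using le_linSpan _ hx))
  symm
  apply Submodule.eq_of_le_of_finrank_le hle
  have hlt : linSpan γ.1 < linSpan γ.1 ⊔ Submodule.span ℚ {x} := by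
    refine lt_of_le_of_ne le_sup_left fun he => hxγ ?_
    refine mem_of_mem_linSpan (Cell.isFaceOf h) hx ?_
    rw [he]
    exact Submodule.mem_sup_right (Submodule.mem_span_singleton_self x)
  have h1 := Submodule.finrank_lt_finrank_of_lt hlt
  have h2 : Module.finrank ℚ (linSpan β.1) = k + 1 := β.2.2.2.1
  have h3 : Module.finrank ℚ (linSpan γ.1) = k := γ.2.2.2.1
  omega

theorem cell_eq_of_mem {k l : ℕ} {α : F.Cell l} {β β' : F.Cell (k + 1)} {γ : F.Cell k}
    (hβ : β.1 ≤ α.1) (hβ' : β'.1 ≤ α.1) (h : γ.1 ≤ β.1) (h' : γ.1 ≤ β'.1)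
    {x : Fin d → ℚ} (hx : x ∈ β.1) (hx' : x ∈ β'.1) (hxγ : x ∉ γ.1) : β = β' := by
  have he : linSpan β.1 = linSpan β'.1 := by
    rw [linSpan_eq_sup h hx hxγ, linSpan_eq_sup h' hx' hxγ]
  apply Subtype.ext
  apply le_antisymm
  · intro y hy
    exact mem_of_mem_linSpan (Cell.isFaceOf hβ') (hβ hy) (he ▸ le_linSpan _ hy)
  · intro y hy
    exact mem_of_mem_linSpan (Cell.isFaceOf hβ) (hβ' hy) (he ▸ le_linSpan _ hy)

/-- The face of `α` spanned by `γ` and an extremal vector. -/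
theorem exists_extremal_cell {k : ℕ} (α : F.Cell (k + 2)) (γ : F.Cell k) (h : γ.1 ≤ α.1)
    (p q : (Fin d → ℚ) →ₗ[ℚ] ℚ)
    (hpq : ∀ x ∈ linSpan α.1, (p x = 0 ∧ q x = 0) ↔ x ∈ linSpan γ.1)
    (hsurj : ∀ a b : ℚ, ∃ x ∈ linSpan α.1, p x = a ∧ q x = b) :
    ∃ w ∈ α.1, w ∉ γ.1 ∧ (∀ y ∈ α.1, 0 ≤ p w * q y - q w * p y) ∧
      (∃ y ∈ α.1, 0 < p w * q y - q w * p y) ∧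
      ∃ β : F.Cell (k + 1), γ.1 ≤ β.1 ∧ β.1 ≤ α.1 ∧
        ∀ y, y ∈ β.1 ↔ y ∈ α.1 ∧ p w * q y - q w * p y = 0 := by
  have hne : ¬ α.1 ≤ γ.1 := fun hle => by
    obtain ⟨w, hw, hw'⟩ := exists_mem_not_mem α γ h (by omega)
    exact hw' (hle hw)
  obtain ⟨w, hw, hwγ, hmin⟩ := exists_extremal (F.fg _ α.2.1) (Cell.isFaceOf h) hne p q hpq
  let D : (Fin d → ℚ) →ₗ[ℚ] ℚ := p w • q - q w • p
  have hD : ∀ y, D y = p w * q y - q w * p y := fun y => by simp [D]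
  have hpos : ∃ y ∈ α.1, 0 < p w * q y - q w * p y := by
    by_contra hc
    push Not at hc
    obtain ⟨x, hx, h1, h2⟩ := hsurj (-q w) (p w)
    have hle : linSpan α.1 ≤ LinearMap.ker D := Submodule.span_le.2 fun y hy => by
      have := le_antisymm (hc y hy) (hmin y hy)
      simpa [hD] using this
    have h3 : D x = 0 := hle hx
    rw [hD, h1, h2] at h3
    apply hwγ
    refine mem_of_mem_linSpan (Cell.isFaceOf h) hw ((hpq w (le_linSpan _ hw)).1 ?_)
    constructor <;> nlinarith [sq_nonneg (p w), sq_nonneg (q w)]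
  let B : PointedCone ℚ (Fin d → ℚ) := α.1 ⊓ PointedCone.ofSubmodule (LinearMap.ker D)
  have hB : ∀ y, y ∈ B ↔ y ∈ α.1 ∧ p w * q y - q w * p y = 0 := fun y => by
    rw [← hD]; rfl
  have hγB : γ.1 ≤ B := fun y hy => by
    rw [hB]
    have := (hpq y (le_linSpan _ (h hy))).2 (le_linSpan _ hy)
    exact ⟨h hy, by rw [this.1, this.2]; ring⟩
  have hBface : B.IsFaceOf α.1 := by
    refine PointedCone.IsFaceOf.of_mem_of_add_mem_left inf_le_left fun {x y} hx hy hxy => ?_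
    rw [hB] at hxy ⊢
    refine ⟨hx, ?_⟩
    have h1 := hmin x hx
    have h2 := hmin y hy
    have h3 := hxy.2
    simp only [map_add] at h3
    linarith
  have hwB : w ∈ B := (hB w).2 ⟨hw, by ring⟩
  have hdim : dim B = k + 1 := by
    have h1 : linSpan γ.1 < linSpan B := lt_of_le_of_ne (linSpan_mono hγB) fun he =>
      hwγ (mem_of_mem_linSpan (Cell.isFaceOf h) hw (he ▸ le_linSpan _ hwB))
    have h2 : linSpan B < linSpan α.1 := lt_of_le_of_ne (linSpan_mono inf_le_left) fun he => by
      obtain ⟨y, hy, hy0⟩ := hpos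
      have := ((hB y).1 (mem_of_mem_linSpan hBface hy (he ▸ le_linSpan _ hy))).2
      linarith
    have h3 := Submodule.finrank_lt_finrank_of_lt h1
    have h4 := Submodule.finrank_lt_finrank_of_lt h2
    have h5 : Module.finrank ℚ (linSpan γ.1) = k := γ.2.2.2.1
    have h6 : Module.finrank ℚ (linSpan α.1) = k + 2 := α.2.2.2.1
    change Module.finrank ℚ (linSpan B) = k + 1
    omega
  exact ⟨w, hw, hwγ, hmin, hpos, ⟨B, F.face_mem _ α.2.1 _ hBface, Nat.succ_pos k, hdim,
    fun ρ hρ hle => γ.2.2.2.2 ρ hρ (hγB.trans hle)⟩, hγB, inf_le_left, hB⟩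

theorem sum_incidence_mul {k : ℕ} (α : F.Cell (k + 2)) (γ : F.Cell k) (h : γ.1 ≤ α.1) :
    ∑ β : F.Cell (k + 1), incidence o α β * incidence o β γ = 0 := by
  classical
  have hd : Module.finrank ℚ (linSpan α.1) = Module.finrank ℚ (linSpan γ.1) + 2 := by
    have h5 : Module.finrank ℚ (linSpan γ.1) = k := γ.2.2.2.1
    have h6 : Module.finrank ℚ (linSpan α.1) = k + 2 := α.2.2.2.1
    omega
  obtain ⟨p, q, hpq, hsurj⟩ := exists_coords (linSpan_mono h) hd
  obtain ⟨w, hw, hwγ, hmin, ⟨y, hy, hy0⟩, β₁, h1, h1', hB1⟩ :=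
    exists_extremal_cell α γ h p q hpq hsurj
  obtain ⟨v, hv, hvγ, hmin', -, β₂, h2, h2', hB2⟩ :=
    exists_extremal_cell α γ h q p (fun x hx => by rw [and_comm]; exact hpq x hx)
      (fun a b => by
        obtain ⟨x, hx, e1, e2⟩ := hsurj b a
        exact ⟨x, hx, e2, e1⟩)
  have hwv : 0 < p w * q v - q w * p v := by
    refine lt_of_le_of_ne (hmin v hv) fun h0 => ?_
    have := plucker_nonneg (Cell.isFaceOf h) p q hpq hy hv hw hvγ
      (by have := hmin' y hy; linarith) (by linarith)
    linarith
  have hwβ₁ : w ∈ β₁.1 := (hB1 w).2 ⟨hw, by ring⟩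
  have hvβ₂ : v ∈ β₂.1 := (hB2 v).2 ⟨hv, by ring⟩
  have hvβ₁ : v ∉ β₁.1 := fun hm => by have := ((hB1 v).1 hm).2; linarith
  have hwβ₂ : w ∉ β₂.1 := fun hm => by have := ((hB2 w).1 hm).2; linarith
  have hne : β₁ ≠ β₂ := fun he => hwβ₂ (he ▸ hwβ₁)
  rw [Finset.sum_eq_add (s := Finset.univ) β₁ β₂ hne]
  · rw [incidence_mul o α β₁ γ h1' h1 ⟨v, le_linSpan _ hv⟩ ⟨w, le_linSpan _ hw⟩ hv hvβ₁ hwβ₁ hwγ,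
      incidence_mul o α β₂ γ h2' h2 ⟨w, le_linSpan _ hw⟩ ⟨v, le_linSpan _ hv⟩ hw hwβ₂ hvβ₂ hvγ,
      det_cons_swap, Left.sign_neg]
    push_cast
    ring
  · rintro β - ⟨hn1, hn2⟩
    by_cases hγβ : γ.1 ≤ β.1
    swap
    · rw [incidence_eq_zero o β γ hγβ, mul_zero]
    by_cases hβα : β.1 ≤ α.1
    swap
    · rw [incidence_eq_zero o α β hβα, zero_mul]
    exfalso
    obtain ⟨x, hx, hxγ⟩ := exists_mem_not_mem β γ hγβ (by omega)
    have hxα := hβα hx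
    have hx1 : 0 < p w * q x - q w * p x := lt_of_le_of_ne (hmin x hxα) fun h0 =>
      hn1 (cell_eq_of_mem hβα h1' hγβ h1 hx ((hB1 x).2 ⟨hxα, h0.symm⟩) hxγ)
    have hx2 : 0 < q v * p x - p v * q x := lt_of_le_of_ne (hmin' x hxα) fun h0 =>
      hn2 (cell_eq_of_mem hβα h2' hγβ h2 hx ((hB2 x).2 ⟨hxα, h0.symm⟩) hxγ)
    have haC := α.1.smul_mem hx2.le hw
    have hbC := α.1.smul_mem hx1.le hv
    have hzC := α.1.add_mem haC hbC
    have hz : (q v * p x - p v * q x) • w + (p w * q x - q w * p x) • v -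
        (p w * q v - q w * p v) • x ∈ linSpan γ.1 := by
      rw [← hpq _ (Submodule.sub_mem _ (le_linSpan _ hzC)
        (Submodule.smul_mem _ _ (le_linSpan _ hxα)))]
      simp only [map_sub, map_add, map_smul, smul_eq_mul]
      constructor <;> ring
    have hz' := Submodule.add_mem _ (linSpan_mono hγβ hz)
      (Submodule.smul_mem _ (p w * q v - q w * p v) (le_linSpan _ hx))
    rw [sub_add_cancel] at hz'
    have hzβ := mem_of_mem_linSpan (Cell.isFaceOf hβα) hzC hz'
    have hmem := (Cell.isFaceOf hβα).mem_of_add_mem_left haC hbC hzβ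
    have hwβ : w ∈ β.1 := by
      have := β.1.smul_mem (inv_nonneg.2 hx2.le) hmem
      rwa [smul_smul, inv_mul_cancel₀ hx2.ne', one_smul] at this
    exact hn1 (cell_eq_of_mem hβα h1' hγβ h1 hwβ hwβ₁ hwγ)
  · intro hn; exact absurd (Finset.mem_univ _) hn
  · intro hn; exact absurd (Finset.mem_univ _) hn

theorem incidence_smul_proj_comp {k : ℕ} (α : F.Cell (k + 2)) (β : F.Cell (k + 1)) (γ : F.Cell k) :
    (incidence o β γ • proj β.1 γ.1) ∘ₗ (incidence o α β • proj α.1 β.1) =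
      (incidence o α β * incidence o β γ) • proj α.1 γ.1 := by
  by_cases hγβ : γ.1 ≤ β.1
  swap
  · simp [incidence_eq_zero o β γ hγβ]
  by_cases hβα : β.1 ≤ α.1
  swap
  · simp [incidence_eq_zero o α β hβα]
  have : proj β.1 γ.1 ∘ₗ proj α.1 β.1 = proj α.1 γ.1 := by
    rw [proj, proj, proj, dif_pos hγβ, dif_pos hβα, dif_pos (hγβ.trans hβα)]
    refine LinearMap.ext fun x => ?_
    obtain ⟨x, rfl⟩ := Submodule.mkQ_surjective _ x
    rw [LinearMap.comp_apply, Submodule.mkQ_apply, Submodule.mapQ_apply, Submodule.mapQ_apply,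
      Submodule.mapQ_apply, LinearMap.id_apply, LinearMap.id_apply]
  rw [LinearMap.smul_comp, LinearMap.comp_smul, this, smul_smul, mul_comm]

theorem boundary_apply {k : ℕ} (y : F.Chain (k + 1)) (β : F.Cell k) :
    boundary o k y β = ∑ α : F.Cell (k + 1), (incidence o α β • proj α.1 β.1) (y α) := by
  simp [boundary, LinearMap.sum_apply]

theorem boundary_comp_boundary (k : ℕ) : boundary o k ∘ₗ boundary o (k + 1) = 0 := by
  refine LinearMap.ext fun x => funext fun γ => ?_
  rw [LinearMap.comp_apply, boundary_apply]
  simp_rw [boundary_apply, map_sum]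
  rw [Finset.sum_comm]
  refine Finset.sum_eq_zero fun α _ => ?_
  have e : ∀ β : F.Cell (k + 1), (incidence o β γ • proj β.1 γ.1)
      ((incidence o α β • proj α.1 β.1) (x α)) =
      (incidence o α β * incidence o β γ) • proj α.1 γ.1 (x α) := fun β => by
    rw [← LinearMap.comp_apply, incidence_smul_proj_comp, LinearMap.smul_apply]
  simp_rw [e]
  rw [← Finset.sum_smul]
  by_cases h : γ.1 ≤ α.1
  · rw [sum_incidence_mul o α γ h, zero_smul]
  · rw [proj, dif_neg h]; simp

variable (F) in
/-- The cycles in degree `k`; everything is a cycle in degree `0`. -/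
def cycles (o : F.CellOrientation) : (k : ℕ) → Submodule (MvPolynomial (Fin d) ℚ) (F.Chain k)
  | 0 => ⊤
  | k + 1 => LinearMap.ker (boundary o k)

/-- The differential `C_{k+1} → C_k`, as a map to the cycles. -/
def boundaryToCycles (k : ℕ) :
    F.Chain (k + 1) →ₗ[MvPolynomial (Fin d) ℚ] F.cycles o k :=
  (boundary o k).codRestrict (F.cycles o k) fun x =>
    match k, x with
    | 0, _ => Submodule.mem_top
    | k + 1, x => LinearMap.congr_fun (boundary_comp_boundary o k) x

variable (F) in
/-- The homology `H_k` of the complex: cycles modulo boundaries. -/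
abbrev homology (o : F.CellOrientation) (k : ℕ) : Type :=
  F.cycles o k ⧸ LinearMap.range (boundaryToCycles o k)

end PolyhedralFan

end FanComplex

end

/-! Fix a prime `P` and let `W` be the space of common zeros of the linear forms in `P`
(`linearZeros P`). Everything follows from one claim: if `P` lies in the support of `H_k`, then `dim
W < k`. Indeed `P` contains the prime ideal of `W`, whose height is at least `d - dim W`, hence at
least `i + 1` when `k = d - i`. If `P` has height exactly `i + 1`, it cannot be strictly larger than
that prime, so it equals it and is generated by linear forms.

For the claim, suppose `dim W ≥ k` and localize at `P`. A summand `S / I_β` of `C_k` survives only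
if `I_β ⊆ P`; then `W` lies in the span of `β`, and by dimension it equals that span. Two faces of
one cone with the same span coincide, so a `(k+1)`-dimensional cell `α` has at most one surviving
facet. If `τ` survives and `α` contains `τ`, the localized differential therefore sends the summand
of `α` onto that of `τ` alone, by plus or minus a projection. So `C_{k+1} → C_k` is surjective at
`P`, and `H_k` vanishes there (`IsHereditary.finrank_linearZeros_lt`).

What remains is polyhedral: for `k < d` every `k`-cell lies in a `(k+1)`-cell
(`IsHereditary.exists_cell_succ`). The star of `τ` has a `d`-dimensional cone, and one descends from
it through intermediate faces, which exist by Farkas' lemma (`exists_intermediate_face`). -/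

namespace FanComplex

/-! ### Farkas' lemma and faces of finitely generated cones -/

/-- **Farkas' lemma** over an ordered field: a vector outside a finitely generated cone is separated
from the cone by a linear functional. -/
theorem exists_dual_neg_of_notMem_hull {K V : Type*} [Field K] [LinearOrder K]
    [IsStrictOrderedRing K] [AddCommGroup V] [Module K V] (t : Finset V) (v : V)
    (hv : v ∉ PointedCone.hull K (t : Set V)) :
    ∃ φ : V →ₗ[K] K, (∀ x ∈ t, 0 ≤ φ x) ∧ φ v < 0 := by
  classical
  induction hn : t.card using Nat.strong_induction_on generalizing t v with
  | _ n ih =>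
  obtain rfl | ⟨a, ha⟩ := t.eq_empty_or_nonempty
  · have hv0 : v ≠ 0 := by rintro rfl; exact hv (Submodule.zero_mem _)
    obtain ⟨φ, hφ⟩ := not_forall.1 (mt (Module.forall_dual_apply_eq_zero_iff K v).1 hv0)
    rcases lt_or_gt_of_ne hφ with h | h
    · exact ⟨φ, by simp, h⟩
    · exact ⟨-φ, by simp, by simpa using h⟩
  · obtain ⟨t, hat, rfl⟩ : ∃ t', a ∉ t' ∧ t = insert a t' :=
      ⟨t.erase a, Finset.notMem_erase a t, (Finset.insert_erase ha).symm⟩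
    have ht : t.card < n := by rw [← hn, Finset.card_insert_of_notMem hat]; exact Nat.lt_succ_self _
    have hsub : PointedCone.hull K (t : Set V) ≤ PointedCone.hull K (insert a t : Finset V) :=
      Submodule.span_mono (by simp)
    have haC : a ∈ PointedCone.hull K ((insert a t : Finset V) : Set V) :=
      Submodule.subset_span (by simp)
    obtain ⟨φ, hφ, hφv⟩ := ih _ ht t v (fun h => hv (hsub h)) rfl
    rcases le_or_gt 0 (φ a) with h0 | h0
    · exact ⟨φ, by simpa using ⟨h0, hφ⟩, hφv⟩
    -- `π` projects onto the kernel of `φ` along `a`. Since `φ a < 0 ≤ φ x` for `x ∈ t`, it moves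
    -- `x` by a nonnegative multiple of `a`, so `π x` stays in the cone; and `v` is `π v` plus a
    -- positive multiple of `a`, so `π v` is outside. A functional separating `π v` from the cone on
    -- `π t` then pulls back along `π` to one that vanishes at `a`.
    let π : V →ₗ[K] V := LinearMap.id - (φ a)⁻¹ • φ.smulRight a
    have hπ : ∀ x, π x = x - ((φ a)⁻¹ * φ x) • a := fun x => by simp [π, smul_smul]
    have hπa : π a = 0 := by rw [hπ, inv_mul_cancel₀ h0.ne, one_smul, sub_self]
    have hpos : ∀ x ∈ t, 0 ≤ -((φ a)⁻¹ * φ x) := fun x hx =>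
      neg_nonneg.2 (mul_nonpos_of_nonpos_of_nonneg (inv_lt_zero.2 h0).le (hφ x hx))
    have hle : PointedCone.hull K ((t.image π : Finset V) : Set V) ≤
        PointedCone.hull K ((insert a t : Finset V) : Set V) := by
      refine Submodule.span_le.2 fun y hy => ?_
      obtain ⟨x, hx, rfl⟩ := Finset.mem_image.1 (Finset.mem_coe.1 hy)
      have h1 := Submodule.add_mem _ (hsub (Submodule.subset_span hx))
        (PointedCone.smul_mem _ (hpos x hx) haC)
      rw [hπ, sub_eq_add_neg, ← neg_smul]
      exact h1
    have hπv : π v ∉ PointedCone.hull K ((t.image π : Finset V) : Set V) := fun h => by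
      have h1 := Submodule.add_mem _ (hle h) (PointedCone.smul_mem _
        (mul_pos_of_neg_of_neg (inv_lt_zero.2 h0) hφv).le haC)
      rw [hπ, sub_add_cancel] at h1
      exact hv h1
    obtain ⟨ψ, hψ, hψv⟩ := ih _ (Finset.card_image_le.trans_lt ht) (t.image π) (π v) hπv rfl
    refine ⟨ψ ∘ₗ π, fun x hx => ?_, hψv⟩
    rcases Finset.mem_insert.1 hx with rfl | hx
    · simp [hπa]
    · exact hψ _ (Finset.mem_image_of_mem π hx)


variable {d : ℕ}

/-- A face of a finitely generated cone is cut out by a linear functional. -/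
theorem exists_functional_of_isFaceOf {G C : PointedCone ℚ (Fin d → ℚ)} (hC : C.FG) (hGfg : G.FG)
    (hG : G.IsFaceOf C) :
    ∃ φ : (Fin d → ℚ) →ₗ[ℚ] ℚ, (∀ x ∈ C, 0 ≤ φ x) ∧ ∀ x ∈ C, φ x = 0 ↔ x ∈ G := by
  classical
  obtain ⟨s, hs⟩ := hC
  obtain ⟨r, hr⟩ := hGfg
  have hsC : ∀ x ∈ s, x ∈ C := fun x hx => hs ▸ Submodule.subset_span hx
  have hrG : ∀ x ∈ r, x ∈ G := fun x hx => hr ▸ Submodule.subset_span hx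
  -- Separate `-g` from the cone `C - G`: if `-g = c - e`, then `g + c = e` lies in the face `G`,
  -- forcing `g ∈ G`. The functional obtained is nonnegative on `C`, zero on `G` and positive at
  -- `g`.
  have hsep : ∀ g : Fin d → ℚ, ∃ φ : (Fin d → ℚ) →ₗ[ℚ] ℚ, g ∈ C → g ∉ G →
      (∀ x ∈ s ∪ r.image (fun x => -x), 0 ≤ φ x) ∧ 0 < φ g := by
    intro g
    by_cases hg : g ∈ C ∧ g ∉ G
    swap
    · exact ⟨0, fun h h' => absurd ⟨h, h'⟩ hg⟩
    have hmem : -g ∉ PointedCone.hull ℚ ((s ∪ r.image (fun x => -x) : Finset _) : Set _) := by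
      intro h
      have key : ∀ y ∈ PointedCone.hull ℚ ((s ∪ r.image (fun x => -x) : Finset _) : Set _),
          ∃ c ∈ C, ∃ e ∈ G, y = c - e := by
        intro y hy
        refine Submodule.span_induction (p := fun y _ => ∃ c ∈ C, ∃ e ∈ G, y = c - e)
          ?_ ?_ ?_ ?_ hy
        · intro x hx
          rcases Finset.mem_union.1 (Finset.mem_coe.1 hx) with hx | hx
          · exact ⟨x, hsC x hx, 0, G.zero_mem, by simp⟩
          · obtain ⟨a, ha, rfl⟩ := Finset.mem_image.1 hx
            exact ⟨0, C.zero_mem, a, hrG a ha, by simp⟩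
        · exact ⟨0, C.zero_mem, 0, G.zero_mem, by simp⟩
        · rintro _ _ - - ⟨c, hc, e, he, rfl⟩ ⟨c', hc', e', he', rfl⟩
          exact ⟨c + c', C.add_mem hc hc', e + e', G.add_mem he he', by abel⟩
        · rintro b _ - ⟨c, hc, e, he, rfl⟩
          exact ⟨b • c, Submodule.smul_mem C b hc, b • e, Submodule.smul_mem G b he,
            smul_sub _ _ _⟩
      obtain ⟨c, hc, e, he, hce⟩ := key _ h
      refine hg.2 (hG.mem_of_add_mem_left hg.1 hc ?_)
      have : g + c = e := by
        rw [← neg_neg g, hce]; abel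
      rwa [this]
    obtain ⟨φ, h1, h2⟩ := exists_dual_neg_of_notMem_hull _ _ hmem
    exact ⟨φ, fun _ _ => ⟨h1, by simpa using h2⟩⟩
  choose φ hφ using hsep
  have hnonneg : ∀ g ∈ C, g ∉ G → ∀ x ∈ C, 0 ≤ φ g x := by
    intro g hg hgG x hx
    rw [← hs] at hx
    refine Submodule.span_induction (p := fun x _ => 0 ≤ φ g x) ?_ ?_ ?_ ?_ hx
    · exact fun x hx => (hφ g hg hgG).1 x (Finset.mem_union_left _ hx)
    · simp
    · intro x y _ _ h1 h2
      rw [map_add]; exact add_nonneg h1 h2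
    · intro c x _ h1
      rw [show φ g (c • x) = (c : ℚ) * φ g x from (φ g).map_smul (c : ℚ) x]
      exact mul_nonneg c.2 h1
  have hzero : ∀ g ∈ C, g ∉ G → ∀ x ∈ G, φ g x = 0 := by
    intro g hg hgG x hx
    refine le_antisymm ?_ (hnonneg g hg hgG x (hG.le hx))
    rw [← hr] at hx
    refine Submodule.span_induction (p := fun x _ => φ g x ≤ 0) ?_ ?_ ?_ ?_ hx
    · intro x hx
      have := (hφ g hg hgG).1 (-x) (Finset.mem_union_right _ (Finset.mem_image_of_mem _ hx))
      simpa using this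
    · simp
    · intro x y _ _ h1 h2
      rw [map_add]; exact add_nonpos h1 h2
    · intro c x _ h1
      rw [show φ g (c • x) = (c : ℚ) * φ g x from (φ g).map_smul (c : ℚ) x]
      exact mul_nonpos_of_nonneg_of_nonpos c.2 h1
  have hfilter : ∀ {g}, g ∈ s.filter (· ∉ G) → g ∈ C ∧ g ∉ G := fun hg =>
    ⟨hsC _ (Finset.mem_filter.1 hg).1, (Finset.mem_filter.1 hg).2⟩
  -- Each generator outside `G` is detected by its own summand, and no summand is negative on `C`.
  let Φ : (Fin d → ℚ) →ₗ[ℚ] ℚ := ∑ g ∈ s.filter (· ∉ G), φ g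
  have hΦ : ∀ x, Φ x = ∑ g ∈ s.filter (· ∉ G), φ g x := fun x => by
    simp [Φ, LinearMap.sum_apply]
  have hΦ0 : ∀ x ∈ C, 0 ≤ Φ x := fun x hx => by
    rw [hΦ]
    exact Finset.sum_nonneg fun g hg => hnonneg g (hfilter hg).1 (hfilter hg).2 x hx
  refine ⟨Φ, hΦ0, fun x hx => ⟨?_, fun hxG => ?_⟩⟩
  · rw [← hs] at hx
    refine Submodule.span_induction (p := fun x _ => Φ x = 0 → x ∈ G) ?_ ?_ ?_ ?_ hx
    · intro x hx h0
      by_contra hxG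
      rw [hΦ] at h0
      have := (Finset.sum_eq_zero_iff_of_nonneg fun g hg =>
        hnonneg g (hfilter hg).1 (hfilter hg).2 x (hsC x hx)).1 h0 x
          (Finset.mem_filter.2 ⟨hx, hxG⟩)
      exact (hφ x (hsC x hx) hxG).2.ne' this
    · exact fun _ => G.zero_mem
    · intro x y hx hy h1 h2 h
      have hx0 := hΦ0 x (hs ▸ hx)
      have hy0 := hΦ0 y (hs ▸ hy)
      rw [map_add] at h
      exact G.add_mem (h1 (by linarith)) (h2 (by linarith))
    · intro c x _ h1 h
      rw [show Φ (c • x) = (c : ℚ) * Φ x from Φ.map_smul (c : ℚ) x] at h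
      rcases mul_eq_zero.1 h with hc | h0
      · rw [show c = 0 from Subtype.ext hc, zero_smul]
        exact G.zero_mem
      · exact Submodule.smul_mem G c (h1 h0)
  · rw [hΦ]
    exact Finset.sum_eq_zero fun g hg => hzero g (hfilter hg).1 (hfilter hg).2 x hxG

/-- A cone meets the span of its face only in that face, so equal spans would force equal cones. -/
theorem dim_lt_of_isFaceOf {G C : PointedCone ℚ (Fin d → ℚ)} (hG : G.IsFaceOf C) (h : ¬ C ≤ G) :
    dim G < dim C := by
  obtain ⟨x, hx, hxG⟩ := SetLike.not_le_iff_exists.1 h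
  exact Submodule.finrank_lt_finrank_of_lt <| lt_of_le_of_ne (Submodule.span_mono hG.le)
    fun he => hxG (PolyhedralFan.mem_of_mem_linSpan hG hx (he ▸ PolyhedralFan.le_linSpan _ hx))

/-- A face of codimension at least two is not a maximal proper face. -/
theorem exists_intermediate_face {G C : PointedCone ℚ (Fin d → ℚ)} (hC : C.FG) (hGfg : G.FG)
    (hG : G.IsFaceOf C) (hdim : dim G + 2 ≤ dim C) :
    ∃ H : PointedCone ℚ (Fin d → ℚ), H.IsFaceOf C ∧ G ≤ H ∧ dim G < dim H ∧ dim H < dim C := by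
  classical
  obtain ⟨φ, hφ, hφG⟩ := exists_functional_of_isFaceOf hC hGfg hG
  obtain ⟨s, hs⟩ := hC
  have hsC : ∀ x ∈ s, x ∈ C := fun x hx => hs ▸ Submodule.subset_span hx
  obtain ⟨e, heC, heG⟩ : ∃ e ∈ C, e ∉ G := SetLike.not_le_iff_exists.1 fun h => by
    rw [le_antisymm h hG.le] at hdim; omega
  obtain ⟨y, hyC, hy⟩ : ∃ y ∈ C, y ∉ linSpan G ⊔ Submodule.span ℚ {e} := by
    by_contra! hc
    have h1 : dim C ≤ _ := Submodule.finrank_mono (Submodule.span_le.2 hc)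
    have h2 := Submodule.finrank_add_le_finrank_add_finrank (linSpan G) (Submodule.span ℚ {e})
    have h3 := finrank_span_le_card (R := ℚ) ({e} : Set (Fin d → ℚ))
    rw [Set.toFinset_singleton, Finset.card_singleton] at h3
    change Module.finrank ℚ (linSpan G) + 2 ≤ _ at hdim
    omega
  -- The functional `φ` supports `C` along `G`. A second functional, zero on `G` and at `e` but not
  -- at `y`, allows tilting `φ` about `G` until it touches a further generator.
  obtain ⟨ψ, hψ, hψy⟩ : ∃ ψ : Module.Dual ℚ (Fin d → ℚ),
      ψ ∈ (linSpan G ⊔ Submodule.span ℚ {e}).dualAnnihilator ∧ ψ y ≠ 0 := by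
    by_contra! hc
    exact hy ((Subspace.forall_mem_dualAnnihilator_apply_eq_zero_iff _ _).1 hc)
  rw [Submodule.mem_dualAnnihilator] at hψ
  have hψe : ψ e = 0 := hψ e (Submodule.mem_sup_right (Submodule.mem_span_singleton_self e))
  have hψG : ∀ x ∈ G, ψ x = 0 := fun x hx =>
    hψ x (Submodule.mem_sup_left (PolyhedralFan.le_linSpan _ hx))
  have hne : (s.filter (· ∉ G)).Nonempty := by
    by_contra h
    rw [Finset.not_nonempty_iff_eq_empty, Finset.filter_eq_empty_iff] at h
    have hle : C ≤ G := hs ▸ Submodule.span_le.2 fun x hx => not_not.1 (h hx)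
    exact heG (hle heC)
  -- The least slope `ψ / φ` over generators outside `G` is the tilt for which `χ = ψ - (ψ g / φ g)
  -- • φ` is still nonnegative on `C` and also vanishes at `g`, so that its zero face is larger than
  -- `G`.
  obtain ⟨g, hg, hmin⟩ := Finset.exists_min_image _ (fun x => ψ x / φ x) hne
  obtain ⟨hgs, hgG⟩ := Finset.mem_filter.1 hg
  have hφpos : ∀ x ∈ C, x ∉ G → 0 < φ x := fun x hx hxG =>
    lt_of_le_of_ne (hφ x hx) fun h => hxG ((hφG x hx).1 h.symm)
  let χ : (Fin d → ℚ) →ₗ[ℚ] ℚ := ψ - (ψ g / φ g) • φ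
  have hχ : ∀ x, χ x = ψ x - ψ g / φ g * φ x := fun x => by simp [χ]
  have hχG : ∀ x ∈ G, χ x = 0 := fun x hx => by
    rw [hχ, hψG x hx, (hφG x (hG.le hx)).2 hx, mul_zero, sub_zero]
  have hχ0 : ∀ x ∈ C, 0 ≤ χ x := by
    intro x hx
    rw [← hs] at hx
    refine Submodule.span_induction (p := fun x _ => 0 ≤ χ x) ?_ ?_ ?_ ?_ hx
    · intro x hx
      by_cases hxG : x ∈ G
      · exact (hχG x hxG).ge
      · have h1 := hmin x (Finset.mem_filter.2 ⟨hx, hxG⟩)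
        rw [le_div_iff₀ (hφpos x (hsC x hx) hxG)] at h1
        rw [hχ]; linarith
    · simp
    · intro x y _ _ h1 h2
      rw [map_add]; exact add_nonneg h1 h2
    · intro c x _ h1
      rw [show χ (c • x) = (c : ℚ) * χ x from χ.map_smul (c : ℚ) x]
      exact mul_nonneg c.2 h1
  let H : PointedCone ℚ (Fin d → ℚ) := C ⊓ PointedCone.ofSubmodule (LinearMap.ker χ)
  have hH : ∀ x, x ∈ H ↔ x ∈ C ∧ χ x = 0 := fun x => Iff.rfl
  have hGH : G ≤ H := fun x hx => (hH x).2 ⟨hG.le hx, hχG x hx⟩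
  have hHC : H.IsFaceOf C := by
    refine PointedCone.IsFaceOf.of_mem_of_add_mem_left inf_le_left fun {x y} hx hy hxy => ?_
    have h1 := ((hH _).1 hxy).2
    rw [map_add] at h1
    exact (hH x).2 ⟨hx, by linarith [hχ0 x hx, hχ0 y hy]⟩
  have hGHface : G.IsFaceOf H := (hG.isFaceOf_iff_le hHC).2 hGH
  refine ⟨H, hHC, hGH, dim_lt_of_isFaceOf hGHface fun h => hgG (h ?_),
    dim_lt_of_isFaceOf hHC fun h => ?_⟩
  · refine (hH g).2 ⟨hsC g hgs, ?_⟩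
    rw [hχ, div_mul_cancel₀ _ (hφpos g (hsC g hgs) hgG).ne', sub_self]
  -- The face is proper: if `χ` vanished at `e`, where `ψ` is zero and `φ` is positive, the slope
  -- would be zero, and then `χ y = 0` would contradict `ψ y ≠ 0`.
  · have h1 := ((hH e).1 (h heC)).2
    have h2 := ((hH y).1 (h hyC)).2
    rw [hχ, hψe, zero_sub, neg_eq_zero] at h1
    rw [hχ, (mul_eq_zero.1 h1).resolve_right (hφpos e heC heG).ne', zero_mul, sub_zero] at h2
    exact hψy h2

/-! ### Cells one dimension up -/

namespace PolyhedralFan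

variable (F : PolyhedralFan d)

theorem isFaceOf_of_le {G C : PointedCone ℚ (Fin d → ℚ)} (hG : G ∈ F.cones) (hC : C ∈ F.cones)
    (h : G ≤ C) : G.IsFaceOf C := by
  have := F.inf_isFaceOf C hC G hG
  rwa [inf_eq_right.2 h] at this

/-- Descent on the excess `n`: while it is positive, an intermediate face of `C` lowers it without
leaving the fan. -/
theorem exists_cone_dim_succ {G : PointedCone ℚ (Fin d → ℚ)} (hG : G ∈ F.cones) (n : ℕ) :
    ∀ C ∈ F.cones, G ≤ C → dim C = dim G + 1 + n →
      ∃ H ∈ F.cones, G ≤ H ∧ dim H = dim G + 1 := by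
  induction n using Nat.strong_induction_on with
  | _ n ih =>
  intro C hC hle hdim
  rcases n.eq_zero_or_pos with rfl | hn
  · exact ⟨C, hC, hle, hdim⟩
  · obtain ⟨H, hH, hGH, h1, h2⟩ := exists_intermediate_face (F.fg C hC) (F.fg G hG)
      (F.isFaceOf_of_le hG hC hle) (by omega)
    exact ih (dim H - (dim G + 1)) (by omega) H (F.face_mem C hC H hH) hGH (by omega)

variable {F}

/-- The descent starts at a `d`-dimensional cone in the star of `τ`. Any cone of the fan containing
an interior cone is itself interior, so the result is a cell. -/
theorem IsHereditary.exists_cell_succ (hF : F.IsHereditary) {k : ℕ} (hk : k < d) (τ : F.Cell k) :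
    ∃ α : F.Cell (k + 1), τ.1 ≤ α.1 := by
  obtain ⟨σ, hσ, hd, hle⟩ := (hF τ.1 τ.2.1).nonempty
  have hdim : dim τ.1 = k := τ.2.2.2.1
  obtain ⟨H, hH, hτH, h⟩ := F.exists_cone_dim_succ τ.2.1 (d - (k + 1)) σ hσ hle (by omega)
  exact ⟨⟨H, hH, Nat.succ_pos k, by omega, fun ρ hρ hle' => τ.2.2.2.2 ρ hρ (hτH.trans hle')⟩, hτH⟩

end PolyhedralFan

end FanComplex

/-! ### Linear forms and ideals of linear subspaces -/

namespace FanComplex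

open MvPolynomial

variable {d : ℕ}

/-- The linear form on `ℚ^d`, as a polynomial. -/
noncomputable def linearForm (d : ℕ) : Module.Dual ℚ (Fin d → ℚ) →ₗ[ℚ] MvPolynomial (Fin d) ℚ where
  toFun ℓ := ∑ i, C (ℓ (Pi.single i 1)) * X i
  map_add' ℓ ℓ' := by simp [add_mul, Finset.sum_add_distrib]
  map_smul' c ℓ := by simp [Finset.smul_sum, smul_eq_C_mul, mul_assoc]

theorem linearForm_apply (ℓ : Module.Dual ℚ (Fin d → ℚ)) :
    linearForm d ℓ = ∑ i, C (ℓ (Pi.single i 1)) * X i := rfl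

theorem aeval_linearForm (ℓ : Module.Dual ℚ (Fin d → ℚ)) (x : Fin d → ℚ) :
    aeval x (linearForm d ℓ) = ℓ x := by
  simp only [linearForm_apply, map_sum, map_mul, aeval_C, aeval_X, Algebra.algebraMap_self_apply]
  conv_rhs => rw [pi_eq_sum_univ' x, map_sum]
  refine Finset.sum_congr rfl fun i _ => ?_
  rw [map_smul, smul_eq_mul, mul_comm]

theorem linearForm_proj (i : Fin d) : linearForm d (LinearMap.proj i) = X i := by
  classical
  rw [linearForm_apply, Finset.sum_eq_single i]
  · simp
  · intro j _ hj
    simp [hj]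
  · simp

theorem isHomogeneous_linearForm (ℓ : Module.Dual ℚ (Fin d → ℚ)) :
    (linearForm d ℓ).IsHomogeneous 1 := by
  rw [linearForm_apply]
  exact IsHomogeneous.sum _ _ _ fun i _ => by
    simpa using (isHomogeneous_C _ _).mul (isHomogeneous_X ℚ i)

theorem linearForm_mem_vanishingIdeal {U : Submodule ℚ (Fin d → ℚ)}
    {ℓ : Module.Dual ℚ (Fin d → ℚ)} :
    linearForm d ℓ ∈ vanishingIdeal ℚ (U : Set (Fin d → ℚ)) ↔ ∀ x ∈ U, ℓ x = 0 := by
  simp only [mem_vanishingIdeal_iff, aeval_linearForm, SetLike.mem_coe]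

/-- The substitution of polynomials induced by a linear endomorphism of `ℚ^d`. -/
noncomputable def substLinear (π : (Fin d → ℚ) →ₗ[ℚ] (Fin d → ℚ)) :
    MvPolynomial (Fin d) ℚ →ₐ[ℚ] MvPolynomial (Fin d) ℚ :=
  aeval fun i => linearForm d (LinearMap.proj i ∘ₗ π)

theorem aeval_substLinear (π : (Fin d → ℚ) →ₗ[ℚ] (Fin d → ℚ)) (f : MvPolynomial (Fin d) ℚ)
    (x : Fin d → ℚ) : aeval x (substLinear π f) = aeval (π x) f := by
  rw [substLinear, ← AlgHom.comp_apply, comp_aeval]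
  simp only [aeval_linearForm]
  rfl

theorem exists_projection (U : Submodule ℚ (Fin d → ℚ)) :
    ∃ π : (Fin d → ℚ) →ₗ[ℚ] (Fin d → ℚ), (∀ x, π x ∈ U) ∧ ∀ x ∈ U, π x = x := by
  obtain ⟨p, hp⟩ := U.subtype.exists_leftInverse_of_injective U.ker_subtype
  exact ⟨U.subtype ∘ₗ p, fun x => (p x).2, fun x hx =>
    congrArg Subtype.val (LinearMap.congr_fun hp ⟨x, hx⟩)⟩

/-- Composing with a projection onto `U` retains only the restriction to `U`, and over an infinite
field a polynomial is determined by its values. This presents the ideal of `U` as the kernel of a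
map into a domain, hence as a prime. -/
theorem substLinear_eq_zero_iff {U : Submodule ℚ (Fin d → ℚ)}
    {π : (Fin d → ℚ) →ₗ[ℚ] (Fin d → ℚ)} (hU : ∀ x, π x ∈ U) (hπ : ∀ x ∈ U, π x = x)
    (f : MvPolynomial (Fin d) ℚ) :
    substLinear π f = 0 ↔ f ∈ vanishingIdeal ℚ (U : Set (Fin d → ℚ)) := by
  rw [mem_vanishingIdeal_iff]
  constructor
  · intro h x hx
    have := aeval_substLinear π f x
    rwa [h, map_zero, hπ x hx, eq_comm] at this
  · intro h
    refine MvPolynomial.funext fun x => ?_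
    rw [map_zero, ← coe_aeval_eq_eval]
    exact (aeval_substLinear π f x).trans (h _ (hU x))

instance isPrime_vanishingIdeal (U : Submodule ℚ (Fin d → ℚ)) :
    (vanishingIdeal ℚ (U : Set (Fin d → ℚ))).IsPrime := by
  obtain ⟨π, hU, hπ⟩ := exists_projection U
  have : vanishingIdeal ℚ (U : Set (Fin d → ℚ)) = RingHom.ker (substLinear π) :=
    Ideal.ext fun f => (substLinear_eq_zero_iff hU hπ f).symm
  rw [this]
  exact RingHom.ker_isPrime _

/-- The ideal of a linear subspace is generated by linear forms. -/
theorem vanishingIdeal_eq_span (U : Submodule ℚ (Fin d → ℚ)) :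
    vanishingIdeal ℚ (U : Set (Fin d → ℚ)) =
      Ideal.span (linearForm d '' {ℓ | ∀ x ∈ U, ℓ x = 0}) := by
  refine le_antisymm (fun f hf => ?_) (Ideal.span_le.2 ?_)
  · obtain ⟨π, hU, hπ⟩ := exists_projection U
    set J := Ideal.span (linearForm d '' {ℓ | ∀ x ∈ U, ℓ x = 0})
    -- Modulo `J` the substitution is the identity, because `x_i ∘ π - x_i` is a linear form
    -- vanishing on `U`. A polynomial that it kills therefore lies in `J`.
    have h : (Ideal.Quotient.mkₐ ℚ J).comp (substLinear π) = Ideal.Quotient.mkₐ ℚ J := by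
      refine MvPolynomial.algHom_ext fun i => ?_
      rw [AlgHom.comp_apply, substLinear, aeval_X]
      refine Ideal.Quotient.eq.2 ?_
      rw [← linearForm_proj i, ← map_sub]
      refine Ideal.subset_span ⟨_, fun x hx => ?_, rfl⟩
      simp [hπ x hx]
    have h1 := DFunLike.congr_fun h f
    rw [AlgHom.comp_apply, (substLinear_eq_zero_iff hU hπ f).2 hf, map_zero] at h1
    exact Ideal.Quotient.eq_zero_iff_mem.1 h1.symm
  · rintro _ ⟨ℓ, hℓ, rfl⟩
    exact linearForm_mem_vanishingIdeal.2 hℓ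

theorem exists_dual_of_notMem {U : Submodule ℚ (Fin d → ℚ)} {x : Fin d → ℚ} (hx : x ∉ U) :
    ∃ ℓ : Module.Dual ℚ (Fin d → ℚ), (∀ y ∈ U, ℓ y = 0) ∧ ℓ x ≠ 0 := by
  by_contra! hc
  exact hx ((Subspace.forall_mem_dualAnnihilator_apply_eq_zero_iff _ _).1 fun ℓ hℓ =>
    hc ℓ ((Submodule.mem_dualAnnihilator _).1 hℓ))

/-- Enlarging `U` by one vector gives a strictly smaller prime, a linear form separating that vector
from `U` being lost; iterating builds a chain of primes. Only this lower bound on the height is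
needed. -/
theorem le_height_vanishingIdeal (n : ℕ) :
    ∀ U : Submodule ℚ (Fin d → ℚ), Module.finrank ℚ U + n = d →
      (n : ℕ∞) ≤ (vanishingIdeal ℚ (U : Set (Fin d → ℚ))).height := by
  induction n with
  | zero => simp
  | succ n ih =>
    intro U hU
    obtain ⟨x, hx⟩ : ∃ x, x ∉ U := by
      by_contra! hc
      rw [(Submodule.eq_top_iff'.2 hc : U = ⊤)] at hU
      simp at hU
    have hrank : Module.finrank ℚ ↥(U ⊔ Submodule.span ℚ {x}) = Module.finrank ℚ U + 1 :=
      Submodule.finrank_sup_span_singleton hx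
    refine (add_le_add_left (ih (U ⊔ Submodule.span ℚ {x}) (by omega)) 1).trans
      (Ideal.height_add_one_le_of_lt_of_isPrime (lt_of_le_not_ge
        (vanishingIdeal_anti_mono (SetLike.coe_subset_coe.2 le_sup_left)) fun hle => ?_))
    obtain ⟨ℓ, hℓ, hℓx⟩ := exists_dual_of_notMem hx
    exact hℓx (linearForm_mem_vanishingIdeal.1 (hle (linearForm_mem_vanishingIdeal.2 hℓ)) x
      (Submodule.mem_sup_right (Submodule.mem_span_singleton_self x)))

/-! ### The linear part of a prime -/

/-- The common zeros of the linear forms in an ideal. -/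
noncomputable def linearZeros (P : Ideal (MvPolynomial (Fin d) ℚ)) : Submodule ℚ (Fin d → ℚ) :=
  ((P.restrictScalars ℚ).comap (linearForm d)).dualCoannihilator

/-- Finite-dimensional biduality: the linear forms in `P` are a subspace of the dual, equal to its
double annihilator. -/
theorem linearForm_mem_iff (P : Ideal (MvPolynomial (Fin d) ℚ)) (ℓ : Module.Dual ℚ (Fin d → ℚ)) :
    linearForm d ℓ ∈ P ↔ ∀ x ∈ linearZeros P, ℓ x = 0 := by
  rw [← Submodule.mem_dualAnnihilator, linearZeros, Subspace.dualCoannihilator_dualAnnihilator_eq]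
  rfl

theorem vanishingIdeal_linearZeros_le (P : Ideal (MvPolynomial (Fin d) ℚ)) :
    vanishingIdeal ℚ (linearZeros P : Set (Fin d → ℚ)) ≤ P := by
  rw [vanishingIdeal_eq_span, Ideal.span_le]
  rintro _ ⟨ℓ, hℓ, rfl⟩
  exact (linearForm_mem_iff P ℓ).2 hℓ

theorem linearZeros_le_of_vanishingIdeal_le {P : Ideal (MvPolynomial (Fin d) ℚ)}
    {U : Submodule ℚ (Fin d → ℚ)} (h : vanishingIdeal ℚ (U : Set (Fin d → ℚ)) ≤ P) :
    linearZeros P ≤ U := by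
  intro x hx
  by_contra hxU
  obtain ⟨ℓ, hℓ, hℓx⟩ := exists_dual_of_notMem hxU
  exact hℓx ((linearForm_mem_iff P ℓ).1 (h (linearForm_mem_vanishingIdeal.2 hℓ)) x hx)

theorem le_height_of_finrank_linearZeros (P : Ideal (MvPolynomial (Fin d) ℚ)) {n : ℕ}
    (h : Module.finrank ℚ (linearZeros P) + n ≤ d) : (n : ℕ∞) ≤ P.height := by
  refine le_trans ?_ (Ideal.height_mono (vanishingIdeal_linearZeros_le P))
  refine le_trans ?_ (le_height_vanishingIdeal (d - Module.finrank ℚ (linearZeros P)) _ (by omega))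
  exact_mod_cast (by omega : n ≤ d - Module.finrank ℚ (linearZeros P))

/-- A prime strictly above the ideal of `linearZeros P` has height at least one more than the
codimension of that subspace, hence more than `n`. -/
theorem eq_vanishingIdeal_of_height_eq (P : Ideal (MvPolynomial (Fin d) ℚ)) [P.IsPrime] {n : ℕ}
    (h : Module.finrank ℚ (linearZeros P) + n ≤ d) (hP : P.height = n) :
    P = vanishingIdeal ℚ (linearZeros P : Set (Fin d → ℚ)) := by
  by_contra hne
  have h1 := Ideal.height_add_one_le_of_lt_of_isPrime
    (lt_of_le_of_ne (vanishingIdeal_linearZeros_le P) (Ne.symm hne))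
  have h2 := le_height_vanishingIdeal (d - Module.finrank ℚ (linearZeros P)) (linearZeros P)
    (by omega)
  rw [hP] at h1
  have h3 := (add_le_add_left h2 1).trans h1
  have h4 : d - Module.finrank ℚ (linearZeros P) + 1 ≤ n := by exact_mod_cast h3
  omega

/-! ### Surjectivity of the differential at a prime -/

namespace PolyhedralFan

variable {F : PolyhedralFan d}

open scoped Classical in
/-- Localized at a prime whose linear forms cut out a subspace of dimension at least `k`, the
differential `C_{k+1} → C_k` is surjective. -/
theorem IsHereditary.exists_smul_single_mem_range (hF : F.IsHereditary) (o : F.CellOrientation)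
    {k : ℕ} (hk : k < d) {P : Ideal (MvPolynomial (Fin d) ℚ)} [P.IsPrime]
    (hP : k ≤ Module.finrank ℚ (linearZeros P)) (τ : F.Cell k)
    (y : MvPolynomial (Fin d) ℚ ⧸ spanIdeal τ.1) :
    ∃ s ∉ P, s • (Pi.single τ y : F.Chain k) ∈ LinearMap.range (boundary o k) := by
  -- An element of `I_β` outside `P` annihilates `S / I_β` and becomes a unit at `P`, so the summand
  -- of such a `β` disappears.
  have hkill : ∀ β : F.Cell k, ¬ linearZeros P ≤ linSpan β.1 → ∃ s ∈ spanIdeal β.1, s ∉ P :=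
    fun β hβ => SetLike.not_le_iff_exists.1 fun h => hβ (linearZeros_le_of_vanishingIdeal_le h)
  obtain ⟨f, rfl⟩ := Ideal.Quotient.mk_surjective y
  by_cases hτ : linearZeros P ≤ linSpan τ.1
  swap
  · obtain ⟨s, hs, hsP⟩ := hkill τ hτ
    refine ⟨s, hsP, ?_⟩
    rw [← Pi.single_smul, show s • Ideal.Quotient.mk (spanIdeal τ.1) f = 0 from
      Ideal.Quotient.eq_zero_iff_mem.2 (Ideal.mul_mem_right f _ hs), Pi.single_zero]
    exact Submodule.zero_mem _
  have heq : ∀ β : F.Cell k, linearZeros P ≤ linSpan β.1 → linearZeros P = linSpan β.1 :=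
    fun β hβ => Submodule.eq_of_le_of_finrank_le hβ (by
      have : Module.finrank ℚ (linSpan β.1) = k := β.2.2.2.1
      omega)
  obtain ⟨α, hα⟩ := hF.exists_cell_succ hk τ
  -- Every facet of `α` other than `τ` has a span different from `linearZeros P`, so it is killed by
  -- some `s ∉ P`. The default `1` for the other cells keeps the product of all the `s β` outside
  -- `P`.
  have hsep : ∀ β : F.Cell k, ∃ s ∉ P, β ≠ τ → β.1 ≤ α.1 → s ∈ spanIdeal β.1 := by
    intro β
    by_cases hβ : β ≠ τ ∧ β.1 ≤ α.1
    · obtain ⟨s, hs, hsP⟩ := hkill β fun h => hβ.1 <| by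
        have he : linSpan β.1 = linSpan τ.1 := (heq β h).symm.trans (heq τ hτ)
        refine Subtype.ext (le_antisymm (fun x hx => ?_) fun x hx => ?_)
        · exact mem_of_mem_linSpan (Cell.isFaceOf hα) (hβ.2 hx) (he ▸ le_linSpan _ hx)
        · exact mem_of_mem_linSpan (Cell.isFaceOf hβ.2) (hα hx) (he ▸ le_linSpan _ hx)
      exact ⟨s, hsP, fun _ _ => hs⟩
    · exact ⟨1, fun h => Ideal.IsPrime.ne_top ‹_› ((Ideal.eq_top_iff_one P).2 h),
        fun h h' => absurd ⟨h, h'⟩ hβ⟩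
  choose s hsP hs using hsep
  have hinc : incidence o α τ * incidence o α τ = 1 := by
    obtain ⟨w, hw, hwτ⟩ := exists_mem_not_mem α τ hα (Nat.lt_succ_self k)
    rw [incidence_eq_sign o α τ hα ⟨w, le_linSpan _ hw⟩ hw hwτ]
    have hne : orientDet o α τ hα ⟨w, le_linSpan _ hw⟩ ≠ 0 := fun h0 => hwτ
      (mem_of_mem_linSpan (Cell.isFaceOf hα) hw ((orientDet_eq_zero_iff o α τ hα _).1 h0))
    rcases lt_or_gt_of_ne hne with h | h
    · rw [sign_neg h]; rfl
    · rw [sign_pos h]; rfl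
  refine ⟨∏ β, s β, fun h => ?_, ?_⟩
  · obtain ⟨β, -, hβ⟩ := (Ideal.IsPrime.prod_mem_iff).1 h
    exact hsP β hβ
  -- The preimage puts `f` on `α`. The factor `incidence o α τ` cancels the sign at `τ`, and the
  -- product kills the components at all other facets of `α`.
  refine ⟨(∏ β, s β) • incidence o α τ • Pi.single α (Ideal.Quotient.mk (spanIdeal α.1) f), ?_⟩
  rw [map_smul, map_zsmul]
  funext β
  rw [Pi.smul_apply, Pi.smul_apply, Pi.smul_apply, boundary_apply, Finset.sum_eq_single α]
  rotate_left
  · intro α' _ h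
    rw [Pi.single_eq_of_ne h, map_zero]
  · intro h; exact absurd (Finset.mem_univ _) h
  rw [Pi.single_eq_same, LinearMap.smul_apply]
  by_cases hβτ : β = τ
  · subst hβτ
    rw [Pi.single_eq_same, smul_smul, hinc, one_smul, proj, dif_pos hα]
    rfl
  · rw [Pi.single_eq_of_ne hβτ, smul_zero]
    by_cases hβ : β.1 ≤ α.1
    · rw [proj, dif_pos hβ, smul_comm, smul_comm (∏ β, s β)]
      have : (∏ β, s β) • Submodule.mapQ (spanIdeal α.1) (spanIdeal β.1) LinearMap.id (spanIdeal_anti hβ)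
          (Ideal.Quotient.mk (spanIdeal α.1) f) = 0 :=
        Ideal.Quotient.eq_zero_iff_mem.2 (Ideal.mul_mem_right f _
          (Ideal.mem_of_dvd _ (Finset.dvd_prod_of_mem s (Finset.mem_univ β)) (hs β hβτ hβ)))
      rw [this, smul_zero, smul_zero]
    · rw [incidence_eq_zero o α β hβ, zero_smul, smul_zero, smul_zero]

theorem IsHereditary.exists_smul_mem_range (hF : F.IsHereditary) (o : F.CellOrientation)
    {k : ℕ} (hk : k < d) {P : Ideal (MvPolynomial (Fin d) ℚ)} [P.IsPrime]
    (hP : k ≤ Module.finrank ℚ (linearZeros P)) (x : F.Chain k) :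
    ∃ s ∉ P, s • x ∈ LinearMap.range (boundary o k) := by
  classical
  choose s hsP hs using fun τ => hF.exists_smul_single_mem_range o hk hP τ (x τ)
  refine ⟨∏ τ, s τ, fun h => ?_, ?_⟩
  · obtain ⟨τ, -, hτ⟩ := (Ideal.IsPrime.prod_mem_iff).1 h
    exact hsP τ hτ
  · rw [← Finset.univ_sum_single x, Finset.smul_sum]
    refine Submodule.sum_mem _ fun τ _ => ?_
    rw [← Finset.prod_erase_mul _ _ (Finset.mem_univ τ), mul_smul]
    exact Submodule.smul_mem _ _ (hs τ)

/-- If the dimension were at least `k`, every cycle would become a boundary after multiplication by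
an element outside `P`. For `k = 0` the conclusion is impossible, so the support is empty, in
accordance with `H_0 = 0`. -/
theorem IsHereditary.finrank_linearZeros_lt (hF : F.IsHereditary) (o : F.CellOrientation)
    {k : ℕ} (hk : k < d) {P : PrimeSpectrum (MvPolynomial (Fin d) ℚ)}
    (hP : P ∈ Module.support (MvPolynomial (Fin d) ℚ) (F.homology o k)) :
    Module.finrank ℚ (linearZeros P.asIdeal) < k := by
  by_contra! h
  refine Module.notMem_support_iff'.2 (fun z => ?_) hP
  obtain ⟨z, rfl⟩ := Submodule.mkQ_surjective _ z
  obtain ⟨s, hs, x, hx⟩ := hF.exists_smul_mem_range o hk h z.1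
  refine ⟨s, hs, ?_⟩
  rw [← map_smul]
  exact (Submodule.Quotient.mk_eq_zero _).2 ⟨x, Subtype.ext hx⟩

end PolyhedralFan

end FanComplex

/-! ### The theorem -/

open FanComplex in
theorem theorem1 {d : ℕ} (F : PolyhedralFan d) (hF : F.IsHereditary) (o : F.CellOrientation)
    (i k : ℕ) (hi : 1 ≤ i) (hk : k + i = d) :
    (∀ P ∈ Module.support (MvPolynomial (Fin d) ℚ) (F.homology o k),
      ((i + 1 : ℕ) : ℕ∞) ≤ P.asIdeal.height) ∧
    (∀ P ∈ associatedPrimes (MvPolynomial (Fin d) ℚ) (F.homology o k),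
      P.height = ((i + 1 : ℕ) : ℕ∞) →
        ∃ L : Set (MvPolynomial (Fin d) ℚ), (∀ l ∈ L, l.IsHomogeneous 1) ∧ P = Ideal.span L) := by
  refine ⟨fun P hP => ?_, fun P hP hht => ?_⟩
  · have := hF.finrank_linearZeros_lt o (by omega) hP
    -- The strict inequality `dim W < k` supplies the extra one: `dim W + (i + 1) ≤ k + i = d`.
    exact le_height_of_finrank_linearZeros _ (by omega)
  · have hprime : P.IsPrime := hP.isPrime
    have hsupp : (⟨P, hprime⟩ : PrimeSpectrum _) ∈
        Module.support (MvPolynomial (Fin d) ℚ) (F.homology o k) := by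
      obtain ⟨z, hz⟩ := hP.2
      rw [Module.mem_support_iff_exists_annihilator]
      refine ⟨z, fun r hr => ?_⟩
      -- The associated prime is the radical of the annihilator of `z`, so it contains that
      -- annihilator and hence lies in the support.
      refine hz.ge (Ideal.le_radical ?_)
      rw [Submodule.mem_colon_singleton, Submodule.mem_bot]
      exact Submodule.mem_annihilator_span_singleton z r |>.1 hr
    have := hF.finrank_linearZeros_lt o (by omega) hsupp
    refine ⟨_, ?_, (eq_vanishingIdeal_of_height_eq P (by simp only at this; omega) hht).trans
      (vanishingIdeal_eq_span _)⟩
    rintro _ ⟨ℓ, -, rfl⟩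
    exact isHomogeneous_linearForm ℓ
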